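/- Let $\mathcal A\subset\mathbb Z^d$ be a finite set that is primitive, i.e. every point of $\mathbb Z^d$ is an integral affine combination of points of $\mathcal A$; let $w=(w_a)_{a\in\mathcal A}$ be positive real weights, and set $f=\sum_{a\in\mathcal A}w_a x^a$, a Laurent polynomial in $x=(x_1,\dots,x_d)$. Let $\Delta\subset\mathbb R^d$ be the convex hull of $\mathcal A$. A *patch* is a family $\beta=(\beta_a)_{a\in\mathcal A}$ of non-negative continuous functions on $\Delta$ without a common zero; its normalized blending functions are $\bar\beta_a=\beta_a/\sum_b\beta_b$ and its tautological map is $\tau:\Delta\to\Delta$, $\tau(x)=\sum_a\bar\beta_a(x)\,a$. The patch is *proper* if $\tau$ is a homeomorphism. It has *linear precision* if $\Lambda(x)=\sum_a\bar\beta_a(x)\Lambda(a)$ on $\Delta$ for every affine function $\Lambda$ on $\mathbb R^d$. Its reparametrization by a homeomorphism $h:\Delta\to\Delta$ is the patch $(\beta_a\circ h)_a$. It has *rational linear precision* if it is proper and its (unique) reparametrization having linear precision has rational normalized blending functions, i.e. each of them agrees with a quotient $P/Q$ of real polynomials, $Q\ne0$, at all points of $\Delta$ where $Q$ does not vanish.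 The patch is a *toric patch of shape* $(\mathcal A,w)$ if the image of $\Delta$ under $x\mapsto[\beta_a(x)\mid a\in\mathcal A]\in\mathbb{RP}^{\mathcal A}$ is equal to the closure of $\{[w_ax^a\mid a\in\mathcal A] : x\in\mathbb R_{>0}^d\}$ in $\mathbb{RP}^{\mathcal A}$. Consider the rational map $$\psi_{\mathcal A,w}=\frac1f\Bigl(x_1\frac{\partial f}{\partial x_1},\dots,x_d\frac{\partial f}{\partial x_d}\Bigr):\ \mathbb C^d\dashrightarrow\mathbb C^d .$$ It is a birational isomorphism if there is a rational map $\chi:\mathbb C^d\dashrightarrow\mathbb C^d$ such that $\psi_{\mathcal A,w}\circ\chi$ and $\chi\circ\psi_{\mathcal A,w}$ are each defined on a non-empty set and equal to the identity where they are defined. Then: 1. A proper toric patch of shape $(\mathcal A,w)$ has rational linear precision if and only if $\psi_{\mathcal A,w}$ is a birational isomorphism. 2. There is a toric patch of shape $(\mathcal A,w)$ that has rational linear precision if and only if $\psi_{\mathcal A,w}$ is a birational isomorphism. -/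

import Mathlib

open scoped LinearAlgebra.Projectivization

noncomputable section

/-! ### Parametric patches -/

section Patches

variable {d : ℕ} {ι : Type*} [Fintype ι]

/-- The domain polytope `Δ`: the convex hull of the finitely many points `pt a`. -/
def domainPolytope (pt : ι → Fin d → ℝ) : Set (Fin d → ℝ) :=
  convexHull ℝ (Set.range pt)

/-- A patch: non-negative continuous blending functions on the domain polytope, indexed by the
points, without a common zero. Only continuity is required, because reparametrizations are by
arbitrary homeomorphisms, which do not preserve smoothness; every smooth patch is a patch here. -/
structure Patch (pt : ι → Fin d → ℝ) where
  /-- The blending functions. -/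
  blend : ι → domainPolytope pt → ℝ
  continuous_blend : ∀ a, Continuous (blend a)
  blend_nonneg : ∀ a x, 0 ≤ blend a x
  no_base_point : ∀ x, ∃ a, blend a x ≠ 0

namespace Patch

variable {pt : ι → Fin d → ℝ} (β : Patch pt)

/-- The sum of the blending functions. -/
def total (x : domainPolytope pt) : ℝ := ∑ a, β.blend a x

/-- The normalized blending functions, which form a partition of unity. -/
def normalized (a : ι) (x : domainPolytope pt) : ℝ := β.blend a x / β.total x

theorem total_pos (x : domainPolytope pt) : 0 < β.total x := by
  obtain ⟨a, ha⟩ := β.no_base_point x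
  exact Finset.sum_pos' (fun b _ => β.blend_nonneg b x)
    ⟨a, Finset.mem_univ a, lt_of_le_of_ne (β.blend_nonneg a x) (Ne.symm ha)⟩

theorem normalized_nonneg (a : ι) (x : domainPolytope pt) : 0 ≤ β.normalized a x :=
  div_nonneg (β.blend_nonneg a x) (β.total_pos x).le

theorem sum_normalized (x : domainPolytope pt) : ∑ a, β.normalized a x = 1 := by
  unfold normalized
  rw [← Finset.sum_div]
  exact div_self (β.total_pos x).ne'

/-- Linear precision: the normalized blending functions replicate all affine functions. -/
def HasLinearPrecision : Prop :=
  ∀ (Λ : (Fin d → ℝ) →ᵃ[ℝ] ℝ) (x : domainPolytope pt),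
    Λ x = ∑ a, β.normalized a x * Λ (pt a)

/-- The tautological map `τ(x) = ∑ β_a(x) a`, as a self-map of the domain polytope. -/
def tautological (x : domainPolytope pt) : domainPolytope pt :=
  ⟨∑ a, β.normalized a x • pt a,
    (convex_convexHull ℝ _).sum_mem (fun a _ => β.normalized_nonneg a x) (β.sum_normalized x)
      (fun a _ => subset_convexHull ℝ _ (Set.mem_range_self a))⟩

/-- A patch is proper if its tautological map is a homeomorphism of the domain polytope. -/
def IsProper : Prop := IsHomeomorph β.tautological

/-- The reparametrization of a patch by a homeomorphism of the domain polytope. -/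
def reparam (h : domainPolytope pt ≃ₜ domainPolytope pt) : Patch pt where
  blend a x := β.blend a (h x)
  continuous_blend a := (β.continuous_blend a).comp h.continuous
  blend_nonneg a x := β.blend_nonneg a (h x)
  no_base_point x := β.no_base_point (h x)

end Patch

/-- A real function on the domain polytope is rational if it is a quotient of two real polynomials.
The denominator, a non-zero polynomial, may vanish at some points of the polytope, where the
formula says nothing (for the blending functions of a patch the value there is then determined by
continuity when the polytope is full-dimensional). -/
def IsRationalFunction {pt : ι → Fin d → ℝ} (g : domainPolytope pt → ℝ) : Prop :=
  ∃ P Q : MvPolynomial (Fin d) ℝ, Q ≠ 0 ∧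
    ∀ x : domainPolytope pt, MvPolynomial.eval x.1 Q ≠ 0 →
      g x = MvPolynomial.eval x.1 P / MvPolynomial.eval x.1 Q

/-- Rational linear precision: the patch is proper, and its (unique) reparametrization that has
linear precision has rational (normalized) blending functions. -/
def Patch.HasRationalLinearPrecision {pt : ι → Fin d → ℝ} (β : Patch pt) : Prop :=
  β.IsProper ∧ ∃ h : domainPolytope pt ≃ₜ domainPolytope pt,
    (β.reparam h).HasLinearPrecision ∧
      ∀ a, IsRationalFunction ((β.reparam h).normalized a)

/-- The quotient topology on the real projective space with coordinates indexed by `ι`. -/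
instance realProjectiveTopology : TopologicalSpace (ℙ ℝ (ι → ℝ)) :=
  TopologicalSpace.coinduced
    (fun v : {v : ι → ℝ // v ≠ 0} => Projectivization.mk ℝ v.1 v.2) inferInstance

/-- The image `X_β` of the domain polytope under `x ↦ [β_a(x) : a]`. -/
def Patch.image {pt : ι → Fin d → ℝ} (β : Patch pt) : Set (ℙ ℝ (ι → ℝ)) :=
  {p | ∃ (x : domainPolytope pt) (h : (fun a => β.blend a x) ≠ 0),
    p = Projectivization.mk ℝ (fun a => β.blend a x) h}

end Patches

/-! ### Toric patches -/

section Toric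

variable {d : ℕ}

/-- `A ⊆ ℤ^d` is primitive if it affinely spans `ℤ^d` (with integer coefficients). -/
def IsPrimitive (A : Finset (Fin d → ℤ)) : Prop :=
  affineSpan ℤ (A : Set (Fin d → ℤ)) = ⊤

/-- The exponent vectors regarded as points of `ℝ^d`. -/
def realPoint (A : Finset (Fin d → ℤ)) (a : A) : Fin d → ℝ := fun i => (a.1 i : ℝ)

/-- `X_{A,w}`: the closure in real projective space of the set of all points `[w_a x^a : a ∈ A]`
with `x` in the positive orthant. -/
def toricNonnegPart (A : Finset (Fin d → ℤ)) (w : A → ℝ) : Set (ℙ ℝ (A → ℝ)) :=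
  closure {p | ∃ x : Fin d → ℝ, (∀ i, 0 < x i) ∧
    ∃ h : (fun a : A => w a * ∏ i, x i ^ a.1 i) ≠ 0,
      p = Projectivization.mk ℝ (fun a : A => w a * ∏ i, x i ^ a.1 i) h}

/-- A toric patch of shape `(A, w)`. -/
def Patch.IsToric {A : Finset (Fin d → ℤ)} (β : Patch (realPoint A)) (w : A → ℝ) : Prop :=
  β.image = toricNonnegPart A w

end Toric

/-! ### Rational self-maps of `ℂ^d` -/

section RationalMaps

variable {d : ℕ}

/-- The field of rational functions on `ℂ^d`. -/
abbrev RationalFunctionField (d : ℕ) : Type := FractionRing (MvPolynomial (Fin d) ℂ)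

/-- The rational function `r` is defined at `x`, with value `z`. -/
def HasValueAt (r : RationalFunctionField d) (x : Fin d → ℂ) (z : ℂ) : Prop :=
  ∃ P Q : MvPolynomial (Fin d) ℂ, MvPolynomial.eval x Q ≠ 0 ∧
    r = algebraMap _ _ P / algebraMap _ _ Q ∧
    z = MvPolynomial.eval x P / MvPolynomial.eval x Q

/-- A rational map `ℂ^d ⇢ ℂ^d`, given by its `d` coordinate functions. -/
abbrev RationalSelfMap (d : ℕ) : Type := Fin d → RationalFunctionField d

namespace RationalSelfMap

/-- The rational map `Φ` is defined at `x`, with value `y`. -/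
def MapsTo (Φ : RationalSelfMap d) (x y : Fin d → ℂ) : Prop :=
  ∀ i, HasValueAt (Φ i) x (y i)

/-- The composition `Ψ ∘ Φ` is defined somewhere (hence on a dense Zariski open set) and is the
identity where it is defined. -/
def CompIsId (Ψ Φ : RationalSelfMap d) : Prop :=
  (∃ x y z, Φ.MapsTo x y ∧ Ψ.MapsTo y z) ∧
    ∀ x y z, Φ.MapsTo x y → Ψ.MapsTo y z → z = x

/-- Birational isomorphisms `ℂ^d ⇢ ℂ^d`: there is a rational map that is an inverse on both sides
where the compositions are defined. -/
def IsBirational (Φ : RationalSelfMap d) : Prop :=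
  ∃ Ψ : RationalSelfMap d, CompIsId Ψ Φ ∧ CompIsId Φ Ψ

end RationalSelfMap

/-- Complex Laurent polynomials in `d` variables. -/
abbrev LaurentPoly (d : ℕ) : Type := AddMonoidAlgebra ℂ (Fin d → ℤ)

namespace LaurentPoly

/-- The Laurent monomial `c x^a`. -/
def monomial (a : Fin d → ℤ) (c : ℂ) : LaurentPoly d := AddMonoidAlgebra.single a c

/-- The variable `x_i`. -/
def X (i : Fin d) : LaurentPoly d := monomial (Pi.single i 1) 1

/-- The partial derivative `∂/∂x_i`, which sends `c x^a` to `c a_i x^(a - e_i)`. -/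
def pderiv (i : Fin d) (p : LaurentPoly d) : LaurentPoly d :=
  p.coeff.sum fun a c => monomial (a - Pi.single i 1) (c * (a i : ℂ))

/-- A Laurent polynomial as a rational function. -/
def toRationalFunction (p : LaurentPoly d) : RationalFunctionField d :=
  p.coeff.sum fun a c => algebraMap _ _ (MvPolynomial.C (σ := Fin d) c) *
    ∏ i, algebraMap _ (RationalFunctionField d) (MvPolynomial.X (R := ℂ) i) ^ a i

end LaurentPoly

/-- `f_{A,w} = ∑ w_a x^a`. -/
def toricPoly (A : Finset (Fin d → ℤ)) (w : A → ℝ) : LaurentPoly d :=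
  ∑ a : A, LaurentPoly.monomial a.1 (w a : ℂ)

/-- The logarithmic toric differential `(1/f) (x_1 ∂f/∂x_1, …, x_d ∂f/∂x_d)`, `f = f_{A,w}`. -/
def logToricDifferential (A : Finset (Fin d → ℤ)) (w : A → ℝ) : RationalSelfMap d := fun i =>
  (LaurentPoly.X i * LaurentPoly.pderiv i (toricPoly A w)).toRationalFunction /
    (toricPoly A w).toRationalFunction

end RationalMaps

end

/-! Normalizing coordinate sums to `1` turns the closed toric set in projective space into a compact
subset `simplexToric` of the standard simplex. The moment map `μ(p) = ∑ p_a a` carries this set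
bijectively onto `Δ` (`momentMap_injOn`, `image_momentMap_simplexToric`). On the monomial
parametrization of positive points, `μ` is exactly the logarithmic toric differential `ψ`.

Linear precision of a patch says that its normalized blending functions `b` satisfy `μ(b(y)) = y`.
For a toric patch `b(y)` also lies in the toric set, so `b` is forced to be the inverse of `μ`.
Hence everything reduces to one question: is `μ⁻¹` rational exactly when `ψ` is birational? A
rational inverse `χ` of `ψ` gives `b_a = w_a χ^a / ∑_c w_c χ^c`. Conversely, primitivity writes each
unit vector as `∑ n_a a` with `∑ n_a = 0`, so that `x_i = ∏ (b_a / w_a)^(n_a)` recovers `x`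
rationally from `b`.

These formulas hold at positive real `x` and at points of the interior of `Δ`. Both sets are Zariski
dense in `ℂ^d`, which promotes the identities to rational maps; continuity extends them to the
boundary of `Δ`. For existence, `μ⁻¹` is itself a proper toric patch. -/

noncomputable section

/-! ### Values of rational functions -/

section Values

variable {d : ℕ} {r s : RationalFunctionField d} {x : Fin d → ℂ} {z z' : ℂ}

theorem algebraMap_rationalFunctionField_ne_zero {Q : MvPolynomial (Fin d) ℂ}
    (hQ : MvPolynomial.eval x Q ≠ 0) :
    algebraMap _ (RationalFunctionField d) Q ≠ 0 := by
  intro h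
  rw [map_eq_zero_iff _ (IsFractionRing.injective _ _)] at h
  simp [h] at hQ

/-- The fraction `P / Q` need not be the one witnessing the value, and `Q` may vanish at `x`.
Cross-multiplying with the witness gives a polynomial identity, which can be evaluated anywhere. -/
theorem HasValueAt.eval_num_eq (h : HasValueAt r x z) {P Q : MvPolynomial (Fin d) ℂ}
    (hQ : Q ≠ 0) (hr : r = algebraMap _ _ P / algebraMap _ _ Q) :
    MvPolynomial.eval x P = z * MvPolynomial.eval x Q := by
  obtain ⟨P', Q', hQ', hr', rfl⟩ := h
  have h0 := algebraMap_rationalFunctionField_ne_zero hQ'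
  have h1 : algebraMap _ (RationalFunctionField d) Q ≠ 0 := by
    rwa [Ne, map_eq_zero_iff _ (IsFractionRing.injective _ _)]
  rw [hr, div_eq_div_iff h1 h0, ← map_mul, ← map_mul] at hr'
  have h2 := congrArg (MvPolynomial.eval x) (IsFractionRing.injective _ _ hr')
  rw [map_mul, map_mul] at h2
  rw [div_mul_eq_mul_div, eq_div_iff hQ', h2]

theorem HasValueAt.unique (h : HasValueAt r x z) (h' : HasValueAt r x z') : z = z' := by
  obtain ⟨P, Q, hQ, hr, rfl⟩ := h
  have hQ0 : Q ≠ 0 := by rintro rfl; simp at hQ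
  rw [div_eq_iff hQ, h'.eval_num_eq hQ0 hr]

theorem hasValueAt_algebraMap (P : MvPolynomial (Fin d) ℂ) (x : Fin d → ℂ) :
    HasValueAt (algebraMap _ _ P) x (MvPolynomial.eval x P) :=
  ⟨P, 1, by simp, by simp, by simp⟩

theorem HasValueAt.add (h : HasValueAt r x z) (h' : HasValueAt s x z') :
    HasValueAt (r + s) x (z + z') := by
  obtain ⟨P, Q, hQ, rfl, rfl⟩ := h
  obtain ⟨P', Q', hQ', rfl, rfl⟩ := h'
  refine ⟨P * Q' + Q * P', Q * Q', by simp [hQ, hQ'], ?_, ?_⟩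
  · simp only [map_add, map_mul]
    exact div_add_div _ _ (algebraMap_rationalFunctionField_ne_zero hQ)
      (algebraMap_rationalFunctionField_ne_zero hQ')
  · simp only [map_add, map_mul]
    exact div_add_div _ _ hQ hQ'

theorem HasValueAt.mul (h : HasValueAt r x z) (h' : HasValueAt s x z') :
    HasValueAt (r * s) x (z * z') := by
  obtain ⟨P, Q, hQ, rfl, rfl⟩ := h
  obtain ⟨P', Q', hQ', rfl, rfl⟩ := h'
  refine ⟨P * P', Q * Q', by simp [hQ, hQ'], ?_, ?_⟩ <;>
  simp only [map_mul, div_mul_div_comm]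

theorem HasValueAt.inv (h : HasValueAt r x z) (hz : z ≠ 0) : HasValueAt r⁻¹ x z⁻¹ := by
  obtain ⟨P, Q, hQ, rfl, rfl⟩ := h
  exact ⟨Q, P, fun h => hz (by simp [h]), by simp, by simp⟩

theorem HasValueAt.div (h : HasValueAt r x z) (h' : HasValueAt s x z') (hz : z' ≠ 0) :
    HasValueAt (r / s) x (z / z') := by
  rw [div_eq_mul_inv, div_eq_mul_inv]
  exact h.mul (h'.inv hz)

theorem hasValueAt_one (x : Fin d → ℂ) : HasValueAt (1 : RationalFunctionField d) x 1 := by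
  simpa using hasValueAt_algebraMap 1 x

theorem hasValueAt_zero (x : Fin d → ℂ) : HasValueAt (0 : RationalFunctionField d) x 0 := by
  simpa using hasValueAt_algebraMap 0 x

theorem HasValueAt.sub (h : HasValueAt r x z) (h' : HasValueAt s x z') :
    HasValueAt (r - s) x (z - z') := by
  have := h.add ((hasValueAt_algebraMap (-1) x).mul h')
  simpa [sub_eq_add_neg] using this

theorem HasValueAt.pow (h : HasValueAt r x z) (n : ℕ) : HasValueAt (r ^ n) x (z ^ n) := by
  induction n with
  | zero => simpa using hasValueAt_one x
  | succ n ih => simpa [pow_succ] using ih.mul h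

theorem HasValueAt.zpow (h : HasValueAt r x z) (hz : z ≠ 0) (n : ℤ) :
    HasValueAt (r ^ n) x (z ^ n) := by
  cases n with
  | ofNat n => simpa using h.pow n
  | negSucc n =>
    simp only [zpow_negSucc]
    exact (h.pow _).inv (pow_ne_zero _ hz)

theorem HasValueAt.finset_sum {κ : Type*} (t : Finset κ) {r : κ → RationalFunctionField d}
    {z : κ → ℂ} (h : ∀ k ∈ t, HasValueAt (r k) x (z k)) :
    HasValueAt (∑ k ∈ t, r k) x (∑ k ∈ t, z k) := by
  classical
  induction t using Finset.induction_on with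
  | empty => simpa using hasValueAt_zero x
  | insert a t ha ih =>
    rw [Finset.sum_insert ha, Finset.sum_insert ha]
    exact (h a (by simp)).add (ih fun k hk => h k (by simp [hk]))

theorem HasValueAt.finset_prod {κ : Type*} (t : Finset κ) {r : κ → RationalFunctionField d}
    {z : κ → ℂ} (h : ∀ k ∈ t, HasValueAt (r k) x (z k)) :
    HasValueAt (∏ k ∈ t, r k) x (∏ k ∈ t, z k) := by
  classical
  induction t using Finset.induction_on with
  | empty => simpa using hasValueAt_one x
  | insert a t ha ih =>
    rw [Finset.prod_insert ha, Finset.prod_insert ha]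
    exact (h a (by simp)).mul (ih fun k hk => h k (by simp [hk]))

/-- Only polynomials are pulled back along `Φ`: for a general rational function the denominator
could become zero after substitution. -/
theorem RationalSelfMap.MapsTo.hasValueAt_aeval {Φ : RationalSelfMap d} {x y : Fin d → ℂ}
    (h : Φ.MapsTo x y) (P : MvPolynomial (Fin d) ℂ) :
    HasValueAt (MvPolynomial.aeval Φ P) x (MvPolynomial.eval y P) := by
  induction P using MvPolynomial.induction_on with
  | C a =>
    simpa [IsScalarTower.algebraMap_apply ℂ (MvPolynomial (Fin d) ℂ) (RationalFunctionField d),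
      MvPolynomial.algebraMap_eq] using hasValueAt_algebraMap (MvPolynomial.C a) x
  | add p q hp hq => simpa using hp.add hq
  | mul_X p i hp => simpa using hp.mul (h i)

theorem exists_num_denom (r : RationalFunctionField d) :
    ∃ P Q : MvPolynomial (Fin d) ℂ, Q ≠ 0 ∧ r = algebraMap _ _ P / algebraMap _ _ Q := by
  obtain ⟨P, Q, hQ, h⟩ := IsFractionRing.div_surjective (MvPolynomial (Fin d) ℂ) r
  exact ⟨P, Q, nonZeroDivisors.ne_zero hQ, h.symm⟩

end Values

/-! ### Zariski dense sets and compositions -/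

section Dense

variable {d : ℕ}

/-- A set of points of `ℂ^d` on which no non-zero polynomial vanishes. -/
def IsZariskiDense (D : Set (Fin d → ℂ)) : Prop :=
  ∀ P : MvPolynomial (Fin d) ℂ, (∀ x ∈ D, MvPolynomial.eval x P = 0) → P = 0

theorem IsZariskiDense.nonempty {D : Set (Fin d → ℂ)} (hD : IsZariskiDense D) : D.Nonempty := by
  by_contra h
  rw [Set.not_nonempty_iff_eq_empty] at h
  exact one_ne_zero (hD 1 (by simp [h]))

theorem IsZariskiDense.inter_ne_zero {D : Set (Fin d → ℂ)} (hD : IsZariskiDense D)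
    {N : MvPolynomial (Fin d) ℂ} (hN : N ≠ 0) :
    IsZariskiDense {x | x ∈ D ∧ MvPolynomial.eval x N ≠ 0} := by
  intro P hP
  have : P * N = 0 := hD _ fun x hx => by
    by_cases h : MvPolynomial.eval x N = 0
    · simp [h]
    · simp [hP x ⟨hx, h⟩]
  exact (mul_eq_zero.1 this).resolve_right hN

theorem IsZariskiDense.eq_zero {D : Set (Fin d → ℂ)} (hD : IsZariskiDense D)
    {r : RationalFunctionField d} (h : ∀ x ∈ D, HasValueAt r x 0) : r = 0 := by
  obtain ⟨P, Q, hQ, hr⟩ := exists_num_denom r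
  rw [hr, hD P fun x hx => by simpa using (h x hx).eval_num_eq hQ hr]
  simp

/-- The real points of a non-empty open subset of `ℝ^d` are Zariski dense in `ℂ^d`. -/
theorem isZariskiDense_ofReal_image {U : Set (Fin d → ℝ)} (hU : IsOpen U) (hne : U.Nonempty) :
    IsZariskiDense ((fun x : Fin d → ℝ => fun i => (x i : ℂ)) '' U) := by
  obtain ⟨u, hu⟩ := hne
  obtain ⟨ε, hε, hball⟩ := Metric.isOpen_iff.1 hU u hu
  intro P hP
  refine MvPolynomial.funext_set (fun i => Complex.ofReal '' Set.Ioo (u i - ε) (u i + ε))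
    (fun i => ?_) fun x hx => ?_
  · exact (Set.Ioo_infinite (by linarith)).image Complex.ofReal_injective.injOn
  · choose y hy using fun i => hx i (Set.mem_univ i)
    rw [map_zero]
    refine hP x ⟨y, hball ?_, funext fun i => (hy i).2⟩
    rw [Metric.mem_ball, dist_pi_lt_iff hε]
    intro i
    rw [Real.dist_eq, abs_lt]
    constructor <;> linarith [(hy i).1.1, (hy i).1.2]

/-- Two rational maps that are inverse to each other at a Zariski dense set of points. -/
theorem RationalSelfMap.compIsId_of_isZariskiDense {Φ Ψ : RationalSelfMap d}
    {D : Set (Fin d → ℂ)} (hD : IsZariskiDense D)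
    (h : ∀ x ∈ D, ∃ y, Φ.MapsTo x y ∧ Ψ.MapsTo y x) : CompIsId Ψ Φ := by
  refine ⟨?_, fun x y z hxy hyz => funext fun j => ?_⟩
  · obtain ⟨x, hx⟩ := hD.nonempty
    obtain ⟨y, hxy, hyx⟩ := h x hx
    exact ⟨x, y, x, hxy, hyx⟩
  · obtain ⟨R, S, hS, hΨ, hz⟩ := hyz j
    have hS0 : S ≠ 0 := by rintro rfl; simp at hS
    -- With `Ψ j = R / S`, the identity `Ψ ∘ Φ = id` is tested in the cleared form `R(Φ) - X_j S(Φ)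
    -- = 0`, which makes sense without knowing `S(Φ) ≠ 0`.
    have hval {x y : Fin d → ℂ} (hxy : Φ.MapsTo x y) :=
      (hxy.hasValueAt_aeval R).sub
        ((hasValueAt_algebraMap (MvPolynomial.X j) x).mul (hxy.hasValueAt_aeval S))
    have h0 := hD.eq_zero (r := MvPolynomial.aeval Φ R -
      algebraMap _ _ (MvPolynomial.X j) * MvPolynomial.aeval Φ S) fun x hx => by
        obtain ⟨y, hxy, hyx⟩ := h x hx
        have := hval hxy
        rwa [(hyx j).eval_num_eq hS0 hΨ, MvPolynomial.eval_X, sub_self] at this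
    have h1 := hval hxy
    rw [h0] at h1
    have h2 := h1.unique (hasValueAt_zero x)
    rw [MvPolynomial.eval_X, sub_eq_zero] at h2
    rw [hz, h2, mul_div_cancel_right₀ _ hS]

end Dense

/-! ### Values of the logarithmic toric differential -/

section LogToric

variable {d : ℕ}

namespace LaurentPoly

theorem toRationalFunction_sum {κ : Type*} (t : Finset κ) (p : κ → LaurentPoly d) :
    (∑ k ∈ t, p k).toRationalFunction = ∑ k ∈ t, (p k).toRationalFunction := by
  unfold toRationalFunction
  rw [AddMonoidAlgebra.coeff_sum]
  exact (Finsupp.sum_finsetSum_index (by simp) (by intros; simp [add_mul])).symm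

theorem toRationalFunction_monomial (a : Fin d → ℤ) (c : ℂ) :
    (monomial a c).toRationalFunction = algebraMap _ _ (MvPolynomial.C (σ := Fin d) c) *
      ∏ i, algebraMap _ (RationalFunctionField d) (MvPolynomial.X (R := ℂ) i) ^ a i := by
  unfold toRationalFunction monomial
  rw [AddMonoidAlgebra.coeff_single, Finsupp.sum_single_index (by simp)]

theorem pderiv_sum {κ : Type*} (i : Fin d) (t : Finset κ) (p : κ → LaurentPoly d) :
    pderiv i (∑ k ∈ t, p k) = ∑ k ∈ t, pderiv i (p k) := by
  unfold pderiv
  rw [AddMonoidAlgebra.coeff_sum]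
  exact (Finsupp.sum_finsetSum_index (by simp [monomial]) (by intros; simp [monomial, add_mul])).symm

theorem X_mul_pderiv_monomial (i : Fin d) (a : Fin d → ℤ) (c : ℂ) :
    X i * pderiv i (monomial a c) = monomial a (c * a i) := by
  unfold pderiv
  rw [monomial, AddMonoidAlgebra.coeff_single, Finsupp.sum_single_index (by simp [monomial])]
  simp [X, monomial, AddMonoidAlgebra.single_mul_single]

theorem hasValueAt_monomial (a : Fin d → ℤ) (c : ℂ) {x : Fin d → ℂ} (hx : ∀ i, x i ≠ 0) :
    HasValueAt (monomial a c).toRationalFunction x (c * ∏ i, x i ^ a i) := by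
  rw [toRationalFunction_monomial]
  refine HasValueAt.mul (by simpa using hasValueAt_algebraMap (MvPolynomial.C c) x)
    (HasValueAt.finset_prod _ fun i _ => HasValueAt.zpow ?_ (hx i) _)
  simpa using hasValueAt_algebraMap (MvPolynomial.X i) x

end LaurentPoly

theorem logToricDifferential_hasValueAt (A : Finset (Fin d → ℤ)) (w : A → ℝ) {x : Fin d → ℂ}
    (hx : ∀ i, x i ≠ 0) (hf : ∑ a : A, (w a : ℂ) * ∏ i, x i ^ a.1 i ≠ 0) (j : Fin d) :
    HasValueAt (logToricDifferential A w j) x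
      ((∑ a : A, (w a : ℂ) * a.1 j * ∏ i, x i ^ a.1 i) /
        ∑ a : A, (w a : ℂ) * ∏ i, x i ^ a.1 i) := by
  unfold logToricDifferential toricPoly
  rw [LaurentPoly.pderiv_sum, Finset.mul_sum, LaurentPoly.toRationalFunction_sum,
    LaurentPoly.toRationalFunction_sum]
  refine HasValueAt.div (HasValueAt.finset_sum _ fun a _ => ?_)
    (HasValueAt.finset_sum _ fun a _ => LaurentPoly.hasValueAt_monomial _ _ hx) hf
  rw [LaurentPoly.X_mul_pderiv_monomial]
  exact LaurentPoly.hasValueAt_monomial _ _ hx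

end LogToric

/-! ### Affine combinations of a primitive set -/

section Primitive

variable {d : ℕ} {A : Finset (Fin d → ℤ)}

theorem IsPrimitive.exists_affine_combination (hA : IsPrimitive A) (z : Fin d → ℤ) :
    ∃ n : A → ℤ, ∑ a, n a = 1 ∧ ∀ j, ∑ a, n a * a.1 j = z j := by
  have hz : z ∈ affineSpan ℤ (Set.range (Subtype.val : A → Fin d → ℤ)) := by
    have : Set.range (Subtype.val : A → Fin d → ℤ) = (A : Set (Fin d → ℤ)) := by ext; simp
    rw [this, hA]
    trivial
  obtain ⟨n, hn, h⟩ := eq_affineCombination_of_mem_affineSpan_of_fintype hz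
  rw [Finset.affineCombination_eq_linear_combination _ _ _ hn] at h
  exact ⟨n, hn, fun j => by rw [h]; simp⟩

/-- The difference of affine combinations for `z` and for `0`. Coefficients of sum zero give
monomials of degree zero, which do not see the scaling of projective coordinates. -/
theorem IsPrimitive.exists_linear_relation (hA : IsPrimitive A) (z : Fin d → ℤ) :
    ∃ n : A → ℤ, ∑ a, n a = 0 ∧ ∀ j, ∑ a, n a * a.1 j = z j := by
  obtain ⟨m, hm, hm'⟩ := hA.exists_affine_combination z
  obtain ⟨n, hn, hn'⟩ := hA.exists_affine_combination 0
  refine ⟨m - n, by simp only [Pi.sub_apply, Finset.sum_sub_distrib, hm, hn, sub_self], fun j => ?_⟩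
  simp only [Pi.sub_apply, sub_mul, Finset.sum_sub_distrib, hm', hn']
  simp

theorem IsPrimitive.affineSpan_realPoint (hA : IsPrimitive A) :
    affineSpan ℝ (Set.range (realPoint A)) = ⊤ := by
  rw [eq_top_iff]
  intro x _
  obtain ⟨n, hn, hn'⟩ := hA.exists_affine_combination 0
  choose m hm hm' using fun i : Fin d => hA.exists_linear_relation (Pi.single i 1)
  -- The weights for `x` combine an affine combination giving the origin with `x i` times a zero-sum
  -- combination giving the `i`-th unit vector.
  have hc : ∑ a, ((n a : ℝ) + ∑ i, x i * m i a) = 1 := by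
    rw [Finset.sum_add_distrib, Finset.sum_comm]
    simp only [← Finset.mul_sum, ← Int.cast_sum, hn, hm]
    simp
  have hx : x = Finset.univ.affineCombination ℝ (realPoint A)
      (fun a => (n a : ℝ) + ∑ i, x i * m i a) := by
    rw [Finset.affineCombination_eq_linear_combination _ _ _ hc]
    ext j
    have h1 : ∑ a : A, (n a : ℝ) * (a.1 j : ℝ) = 0 := by exact_mod_cast hn' j
    have h2 : ∀ i, ∑ a : A, (m i a : ℝ) * (a.1 j : ℝ) = (Pi.single i 1 : Fin d → ℝ) j := by
      intro i
      have := hm' i j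
      have h3 : (((Pi.single i 1 : Fin d → ℤ) j : ℤ) : ℝ) = (Pi.single i 1 : Fin d → ℝ) j := by
        by_cases h : j = i
        · subst h; simp
        · simp [h]
      rw [← h3, ← this]
      push_cast
      rfl
    simp only [Finset.sum_apply, Pi.smul_apply, smul_eq_mul, realPoint, add_mul,
      Finset.sum_add_distrib, h1, Finset.sum_mul]
    rw [Finset.sum_comm]
    simp only [mul_assoc, ← Finset.mul_sum, h2]
    simp [Pi.single_apply]
  rw [hx]
  exact affineCombination_mem_affineSpan hc _

theorem IsPrimitive.interior_domainPolytope_nonempty (hA : IsPrimitive A) :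
    (interior (domainPolytope (realPoint A))).Nonempty :=
  interior_convexHull_nonempty_iff_affineSpan_eq_top.2 hA.affineSpan_realPoint

theorem IsPrimitive.nonempty (hA : IsPrimitive A) : Nonempty A := by
  obtain ⟨n, hn, -⟩ := hA.exists_affine_combination 0
  by_contra h
  rw [not_nonempty_iff] at h
  simp at hn

theorem isCompact_domainPolytope (A : Finset (Fin d → ℤ)) :
    IsCompact (domainPolytope (realPoint A)) :=
  (Set.finite_range _).isCompact_convexHull ℝ

theorem IsPrimitive.closure_interior_domainPolytope (hA : IsPrimitive A) :
    closure (interior (domainPolytope (realPoint A))) = domainPolytope (realPoint A) := by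
  exact ((convex_convexHull ℝ _).closure_interior_eq_closure_of_nonempty_interior
    hA.interior_domainPolytope_nonempty).trans (isCompact_domainPolytope A).isClosed.closure_eq

end Primitive

/-! ### The non-negative part of the toric variety in the simplex, and the moment map -/

section Birch

variable {d : ℕ} {A : Finset (Fin d → ℤ)} {w : A → ℝ} {x : Fin d → ℝ}

/-- The monomials `w_a x^a`. -/
def weightedMonomial (A : Finset (Fin d → ℤ)) (w : A → ℝ) (x : Fin d → ℝ) (a : A) : ℝ :=
  w a * ∏ i, x i ^ a.1 i

/-- The point `[w_a x^a : a ∈ A]`, with coordinates of sum `1`. -/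
def simplexPoint (A : Finset (Fin d → ℤ)) (w : A → ℝ) (x : Fin d → ℝ) (a : A) : ℝ :=
  weightedMonomial A w x a / ∑ b, weightedMonomial A w x b

/-- `X_{A,w}`, as a subset of the standard simplex. -/
def simplexToric (A : Finset (Fin d → ℤ)) (w : A → ℝ) : Set (A → ℝ) :=
  closure (simplexPoint A w '' {x | ∀ i, 0 < x i})

/-- The algebraic moment map. -/
def momentMap (A : Finset (Fin d → ℤ)) (p : A → ℝ) : Fin d → ℝ := ∑ a, p a • realPoint A a

theorem continuous_momentMap (A : Finset (Fin d → ℤ)) : Continuous (momentMap A) := by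
  unfold momentMap; fun_prop

theorem momentMap_apply (A : Finset (Fin d → ℤ)) (p : A → ℝ) (j : Fin d) :
    momentMap A p j = ∑ a : A, p a * a.1 j := by
  simp [momentMap, realPoint]

theorem weightedMonomial_pos (hw : ∀ a, 0 < w a) (hx : ∀ i, 0 < x i) (a : A) :
    0 < weightedMonomial A w x a :=
  mul_pos (hw a) (Finset.prod_pos fun i _ => zpow_pos (hx i) _)

theorem sum_weightedMonomial_pos [Nonempty A] (hw : ∀ a, 0 < w a) (hx : ∀ i, 0 < x i) :
    0 < ∑ a, weightedMonomial A w x a :=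
  Finset.sum_pos (fun a _ => weightedMonomial_pos hw hx a) Finset.univ_nonempty

theorem simplexPoint_pos [Nonempty A] (hw : ∀ a, 0 < w a) (hx : ∀ i, 0 < x i) (a : A) :
    0 < simplexPoint A w x a :=
  div_pos (weightedMonomial_pos hw hx a) (sum_weightedMonomial_pos hw hx)

theorem sum_simplexPoint [Nonempty A] (hw : ∀ a, 0 < w a) (hx : ∀ i, 0 < x i) :
    ∑ a, simplexPoint A w x a = 1 := by
  unfold simplexPoint
  rw [← Finset.sum_div, div_self (sum_weightedMonomial_pos hw hx).ne']

theorem simplexPoint_mem (hx : ∀ i, 0 < x i) : simplexPoint A w x ∈ simplexToric A w :=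
  subset_closure ⟨x, hx, rfl⟩

theorem simplexToric_subset_stdSimplex [Nonempty A] (hw : ∀ a, 0 < w a) :
    simplexToric A w ⊆ stdSimplex ℝ A := by
  refine closure_minimal ?_ (isClosed_stdSimplex ℝ A)
  rintro _ ⟨x, hx, rfl⟩
  exact ⟨fun a => (simplexPoint_pos hw hx a).le, sum_simplexPoint hw hx⟩

theorem isCompact_simplexToric [Nonempty A] (hw : ∀ a, 0 < w a) :
    IsCompact (simplexToric A w) :=
  (isCompact_stdSimplex ℝ A).of_isClosed_subset isClosed_closure
    (simplexToric_subset_stdSimplex hw)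

theorem momentMap_mem [Nonempty A] (hw : ∀ a, 0 < w a) {p : A → ℝ} (hp : p ∈ simplexToric A w) :
    momentMap A p ∈ domainPolytope (realPoint A) :=
  have h := simplexToric_subset_stdSimplex hw hp
  (convex_convexHull ℝ _).sum_mem (fun a _ => h.1 a) h.2
    (fun a _ => subset_convexHull ℝ _ (Set.mem_range_self a))

theorem log_weightedMonomial_div (hw : ∀ a, 0 < w a) (hx : ∀ i, 0 < x i) (a : A) :
    Real.log (weightedMonomial A w x a / w a) = ∑ i, Real.log (x i) * a.1 i := by
  rw [weightedMonomial, mul_div_cancel_left₀ _ (hw a).ne',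
    Real.log_prod fun i _ => (zpow_pos (hx i) _).ne']
  exact Finset.sum_congr rfl fun i _ => by rw [Real.log_zpow, mul_comm]

/-- The points of `X_{A,w}` satisfy the binomial equations with real exponents. -/
theorem prod_rpow_eq_of_mem_simplexToric [Nonempty A] (hw : ∀ a, 0 < w a) {u v : A → ℝ}
    (hu : ∀ a, 0 ≤ u a) (hv : ∀ a, 0 ≤ v a) (hsum : ∑ a, u a = ∑ a, v a)
    (huv : momentMap A u = momentMap A v) {p : A → ℝ} (hp : p ∈ simplexToric A w) :
    ∏ a, (p a / w a) ^ u a = ∏ a, (p a / w a) ^ v a := by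
  -- Non-negative exponents keep the product continuous where coordinates vanish, so the equations
  -- pass to the closure.
  have hcont {u : A → ℝ} (hu : ∀ a, 0 ≤ u a) :
      Continuous fun p : A → ℝ => ∏ a, (p a / w a) ^ u a :=
    continuous_finsetProd _ fun a _ =>
      ((continuous_apply a).div_const _).rpow_const fun _ => Or.inr (hu a)
  refine closure_minimal (t := {p | ∏ a, (p a / w a) ^ u a = ∏ a, (p a / w a) ^ v a})
    ?_ (isClosed_eq (hcont hu) (hcont hv)) hp
  rintro _ ⟨x, hx, rfl⟩
  -- On the parametrized points the product depends on `u` only through its moment and its sum.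
  have key (u : A → ℝ) : ∏ a, (simplexPoint A w x a / w a) ^ u a =
      Real.exp (∑ i, Real.log (x i) * momentMap A u i -
        Real.log (∑ b, weightedMonomial A w x b) * ∑ a, u a) := by
    have h (a : A) : (simplexPoint A w x a / w a) ^ u a =
        Real.exp (∑ i, Real.log (x i) * (u a * a.1 i) -
          Real.log (∑ b, weightedMonomial A w x b) * u a) := by
      rw [Real.rpow_def_of_pos (div_pos (simplexPoint_pos hw hx a) (hw a)), simplexPoint,
        div_right_comm, Real.log_div (div_pos (weightedMonomial_pos hw hx a) (hw a)).ne'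
          (sum_weightedMonomial_pos hw hx).ne', log_weightedMonomial_div hw hx, sub_mul,
        Finset.sum_mul]
      congr 2
      exact Finset.sum_congr rfl fun i _ => by ring
    rw [Finset.prod_congr rfl fun a _ => h a, ← Real.exp_sum, Finset.sum_sub_distrib,
      Finset.sum_comm]
    simp only [← Finset.mul_sum, momentMap_apply]
  simp only [Set.mem_ofPred_eq, key, hsum, huv]

/-- Two points `p`, `q` with equal moments serve themselves as exponents in the binomial equations.
Since `0 ^ 0 = 1`, the product with base and exponent `p` is positive, so the one with base `p` and
exponent `q` is too; by symmetry the supports agree. Taking logarithms at `p` and at `q` and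
subtracting gives `∑ (p_a - q_a)(log (p_a/w_a) - log (q_a/w_a)) = 0`. As `log` is strictly
increasing, no term is negative, and a term vanishes only if `p_a = q_a`. -/
theorem momentMap_injOn [Nonempty A] (hw : ∀ a, 0 < w a) :
    Set.InjOn (momentMap A) (simplexToric A w) := by
  intro p hp q hq hpq
  obtain ⟨hp0, hp1⟩ := simplexToric_subset_stdSimplex hw hp
  obtain ⟨hq0, hq1⟩ := simplexToric_subset_stdSimplex hw hq
  have hbin {r : A → ℝ} (hr : r ∈ simplexToric A w) :=
    prod_rpow_eq_of_mem_simplexToric hw hp0 hq0 (hp1.trans hq1.symm) hpq hr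
  have hpos {r : A → ℝ} (hr : ∀ a, 0 ≤ r a) : 0 < ∏ a, (r a / w a) ^ r a := by
    refine Finset.prod_pos fun a _ => ?_
    rcases (hr a).eq_or_lt with h | h
    · simp [← h]
    · exact Real.rpow_pos_of_pos (div_pos h (hw a)) _
  have hsupp {r s : A → ℝ} (hr : ∀ a, 0 ≤ r a)
      (h : 0 < ∏ a, (r a / w a) ^ s a) (a : A) (hs : s a ≠ 0) : 0 < r a := by
    refine lt_of_le_of_ne (hr a) fun h0 => ?_
    rw [Finset.prod_eq_zero (Finset.mem_univ a)] at h
    · exact lt_irrefl _ h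
    · simp [← h0, Real.zero_rpow hs]
  have hqp (a : A) : q a ≠ 0 → 0 < p a := hsupp hp0 (hbin hp ▸ hpos hp0) a
  have hpq' (a : A) : p a ≠ 0 → 0 < q a := hsupp hq0 ((hbin hq).symm ▸ hpos hq0) a
  have hlog {r : A → ℝ} (hr : ∀ a, p a ≠ 0 ∨ q a ≠ 0 → 0 < r a)
      (h : ∏ a, (r a / w a) ^ p a = ∏ a, (r a / w a) ^ q a) :
      ∑ a, (p a - q a) * Real.log (r a / w a) = 0 := by
    have hl {s : A → ℝ} (hs : ∀ a, s a ≠ 0 → 0 < r a) :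
        Real.log (∏ a, (r a / w a) ^ s a) = ∑ a, s a * Real.log (r a / w a) := by
      rw [Real.log_prod]
      · refine Finset.sum_congr rfl fun a _ => ?_
        by_cases h0 : s a = 0
        · simp [h0]
        · rw [Real.log_rpow (div_pos (hs a h0) (hw a))]
      · intro a _
        by_cases h0 : s a = 0
        · simp [h0]
        · exact (Real.rpow_pos_of_pos (div_pos (hs a h0) (hw a)) _).ne'
    have := congrArg Real.log h
    rw [hl fun a ha => hr a (Or.inl ha), hl fun a ha => hr a (Or.inr ha)] at this
    simp only [sub_mul, Finset.sum_sub_distrib, this, sub_self]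
  have hp2 := hlog (r := p) (fun a h => h.elim (fun h => lt_of_le_of_ne (hp0 a) h.symm) (hqp a))
    (hbin hp)
  have hq2 := hlog (r := q) (fun a h => h.elim (hpq' a) (fun h => lt_of_le_of_ne (hq0 a) h.symm))
    (hbin hq)
  have hsum : ∑ a, (p a - q a) * (Real.log (p a / w a) - Real.log (q a / w a)) = 0 := by
    simp only [mul_sub, Finset.sum_sub_distrib]
    rw [hp2, hq2, sub_zero]
  have hterm (a : A) : p a ≠ q a →
      0 < (p a - q a) * (Real.log (p a / w a) - Real.log (q a / w a)) := by
    intro hne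
    have hpa : 0 < p a := by
      by_cases h : q a = 0
      · exact lt_of_le_of_ne (hp0 a) fun h' => hne (h'.symm.trans h.symm)
      · exact hqp a h
    have hqa : 0 < q a := hpq' a hpa.ne'
    rcases lt_or_gt_of_ne hne with h | h
    · refine mul_pos_of_neg_of_neg (sub_neg.2 h) (sub_neg.2 (Real.log_lt_log ?_ ?_))
      · exact div_pos hpa (hw a)
      · exact div_lt_div_of_pos_right h (hw a)
    · refine mul_pos (sub_pos.2 h) (sub_pos.2 (Real.log_lt_log ?_ ?_))
      · exact div_pos hqa (hw a)
      · exact div_lt_div_of_pos_right h (hw a)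
  have hterm' (a : A) : 0 ≤ (p a - q a) * (Real.log (p a / w a) - Real.log (q a / w a)) := by
    by_cases h : p a = q a
    · simp [h]
    · exact (hterm a h).le
  ext a
  by_contra h
  exact (hterm a h).ne' ((Finset.sum_eq_zero_iff_of_nonneg fun a _ => hterm' a).1 hsum a
    (Finset.mem_univ a))

/-- Linear forms attain a large value at a vertex, as seen from an interior point. -/
theorem exists_le_sum_mul_sub_of_mem_interior {y : Fin d → ℝ}
    (hy : y ∈ interior (domainPolytope (realPoint A))) :
    ∃ ε > 0, ∀ t : Fin d → ℝ, ∃ a : A, ε * ‖t‖ ≤ ∑ i, t i * (a.1 i - y i) := by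
  obtain ⟨ε, hε, hball⟩ := Metric.isOpen_iff.1 isOpen_interior y hy
  refine ⟨ε / 2, half_pos hε, fun t => ?_⟩
  by_contra! hlt
  -- Moving from `y` along the signs of `t` stays in the polytope and raises the form by `ε / 2`
  -- times the `ℓ¹` norm of `t`, which is at least its sup norm. Smaller values at all points of `A`
  -- would contradict this by convexity.
  let s : Fin d → ℝ := fun i => ε / 2 * SignType.sign (t i)
  have hs : y + s ∈ domainPolytope (realPoint A) := by
    refine interior_subset (hball ?_)
    rw [Metric.mem_ball, dist_self_add_left]
    refine ((pi_norm_le_iff_of_nonneg (half_pos hε).le).2 fun i => ?_).trans_lt (half_lt_self hε)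
    rcases lt_trichotomy (t i) 0 with h | h | h <;> simp [s, h, abs_of_pos hε, (half_pos hε).le]
  have hconv : Convex ℝ {z : Fin d → ℝ | ∑ i, t i * (z i - y i) < ε / 2 * ‖t‖} := by
    have : IsLinearMap ℝ fun z : Fin d → ℝ => ∑ i, t i * z i :=
      ⟨fun u v => by simp [mul_add, Finset.sum_add_distrib],
       fun c u => by simp [Finset.mul_sum, mul_left_comm]⟩
    have h2 := convex_halfSpace_lt this (ε / 2 * ‖t‖ + ∑ i, t i * y i)
    have h3 (z : Fin d → ℝ) : ∑ i, t i * (z i - y i) < ε / 2 * ‖t‖ ↔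
        ∑ i, t i * z i < ε / 2 * ‖t‖ + ∑ i, t i * y i := by
      simp only [mul_sub, Finset.sum_sub_distrib]
      exact sub_lt_iff_lt_add
    simpa only [h3] using h2
  have hlt' : ∑ i, t i * ((y + s) i - y i) < ε / 2 * ‖t‖ := by
    refine convexHull_min ?_ hconv hs
    rintro _ ⟨a, rfl⟩
    exact hlt a
  refine absurd hlt' (not_lt.2 ?_)
  have h1 : ∑ i, t i * ((y + s) i - y i) = ε / 2 * ∑ i, ‖t i‖ := by
    rw [Finset.mul_sum]
    refine Finset.sum_congr rfl fun i _ => ?_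
    rw [Real.norm_eq_abs, ← sign_mul_self]
    simp only [Pi.add_apply, s]
    ring
  rw [h1]
  refine mul_le_mul_of_nonneg_left ?_ (half_pos hε).le
  exact (pi_norm_le_iff_of_nonneg (Finset.sum_nonneg fun i _ => norm_nonneg _)).2 fun i =>
    Finset.single_le_sum (f := fun i => ‖t i‖) (fun i _ => norm_nonneg _) (Finset.mem_univ i)

/-- Birch's theorem: every interior point of the polytope is the image under the moment map of a
point with positive coordinates. -/
theorem exists_momentMap_simplexPoint_eq [Nonempty A] (hw : ∀ a, 0 < w a) {y : Fin d → ℝ}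
    (hy : y ∈ interior (domainPolytope (realPoint A))) :
    ∃ x : Fin d → ℝ, (∀ i, 0 < x i) ∧ momentMap A (simplexPoint A w x) = y := by
  obtain ⟨ε, hε, hlarge⟩ := exists_le_sum_mul_sub_of_mem_interior hy
  -- With `x = exp t` this is `x^(-y) f(x)`. Its critical points are the solutions of the moment
  -- equation, and its growth at infinity provides a minimum.
  let g : (Fin d → ℝ) → ℝ := fun t => ∑ a : A, w a * Real.exp (∑ i, t i * (a.1 i - y i))
  have hg : Continuous g := by fun_prop
  obtain ⟨m, hm, hwm⟩ : ∃ m : ℝ, 0 < m ∧ ∀ a, m ≤ w a := by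
    obtain ⟨a₀, ha₀⟩ := Finite.exists_min w
    exact ⟨w a₀, hw a₀, ha₀⟩
  have hgt : Filter.Tendsto g (Filter.cocompact _) Filter.atTop := by
    refine Filter.tendsto_atTop_mono (f := fun t => m * Real.exp (ε * ‖t‖)) (fun t => ?_) ?_
    · obtain ⟨a, ha⟩ := hlarge t
      calc m * Real.exp (ε * ‖t‖) ≤ w a * Real.exp (∑ i, t i * (a.1 i - y i)) :=
            mul_le_mul (hwm a) (Real.exp_le_exp.2 ha) (Real.exp_pos _).le (hw a).le
        _ ≤ g t := Finset.single_le_sum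
            (f := fun a : A => w a * Real.exp (∑ i, t i * (a.1 i - y i)))
            (fun b _ => (mul_pos (hw b) (Real.exp_pos _)).le) (Finset.mem_univ a)
    · exact (Real.tendsto_exp_atTop.comp
        ((tendsto_norm_cocompact_atTop).const_mul_atTop hε)).const_mul_atTop hm
  obtain ⟨t, ht⟩ := hg.exists_forall_le hgt
  have hcrit (j : Fin d) :
      ∑ a : A, w a * (Real.exp (∑ i, t i * (a.1 i - y i)) * (a.1 j - y j)) = 0 := by
    let γ : ℝ → ℝ := fun s => ∑ a : A, w a *
      Real.exp (∑ i, t i * (a.1 i - y i) + s * (a.1 j - y j))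
    have hγ (s : ℝ) : γ s = g (t + s • Pi.single j 1) := by
      refine Finset.sum_congr rfl fun a _ => ?_
      congr 2
      simp [add_mul, Finset.sum_add_distrib, Pi.single_apply]
    have hmin : IsLocalMin γ 0 := Filter.Eventually.of_forall fun s => by
      rw [hγ, hγ, zero_smul, add_zero]
      exact ht _
    have hder : HasDerivAt γ
        (∑ a : A, w a * (Real.exp (∑ i, t i * (a.1 i - y i)) * (a.1 j - y j))) 0 := by
      refine HasDerivAt.fun_sum fun a _ => HasDerivAt.const_mul _ ?_
      have := (((hasDerivAt_id (0 : ℝ)).mul_const ((a.1 j : ℝ) - y j)).const_add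
        (∑ i, t i * ((a.1 i : ℝ) - y i))).exp
      simpa using this
    exact hmin.hasDerivAt_eq_zero hder
  have hx : ∀ i, 0 < Real.exp (t i) := fun i => Real.exp_pos _
  refine ⟨fun i => Real.exp (t i), hx, funext fun j => ?_⟩
  have hmon (a : A) : w a * Real.exp (∑ i, t i * (a.1 i - y i)) =
      weightedMonomial A w (fun i => Real.exp (t i)) a * Real.exp (-∑ i, t i * y i) := by
    rw [weightedMonomial, mul_assoc]
    congr 1
    have : ∏ i, Real.exp (t i) ^ a.1 i = Real.exp (∑ i, t i * a.1 i) := by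
      rw [Real.exp_sum]
      exact Finset.prod_congr rfl fun i _ => by
        rw [← Real.rpow_intCast, ← Real.exp_mul]
    rw [this, ← Real.exp_add]
    simp only [mul_sub, Finset.sum_sub_distrib]
    rw [sub_eq_add_neg]
  have h0 : ∑ a : A, weightedMonomial A w (fun i => Real.exp (t i)) a * (a.1 j - y j) = 0 := by
    have h1 := hcrit j
    simp only [← mul_assoc, hmon] at h1
    simp only [mul_right_comm _ (Real.exp _), ← Finset.sum_mul] at h1
    exact (mul_eq_zero.1 h1).resolve_right (Real.exp_pos _).ne'
  simp only [mul_sub, Finset.sum_sub_distrib, ← Finset.sum_mul] at h0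
  rw [momentMap_apply]
  simp only [simplexPoint, div_mul_eq_mul_div]
  rw [← Finset.sum_div, div_eq_iff (sum_weightedMonomial_pos hw hx).ne', sub_eq_zero.1 h0, mul_comm]

/-- The image is compact, hence closed, and contains the interior of the polytope by Birch's
theorem; the polytope is the closure of its interior. -/
theorem image_momentMap_simplexToric (hA : IsPrimitive A) (hw : ∀ a, 0 < w a) :
    momentMap A '' simplexToric A w = domainPolytope (realPoint A) := by
  have := hA.nonempty
  refine Set.Subset.antisymm (Set.image_subset_iff.2 fun p hp => momentMap_mem hw hp) ?_
  rw [← hA.closure_interior_domainPolytope]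
  refine closure_minimal (fun y hy => ?_)
    ((isCompact_simplexToric hw).image (continuous_momentMap A)).isClosed
  obtain ⟨x, hx, rfl⟩ := exists_momentMap_simplexPoint_eq hw hy
  exact ⟨_, simplexPoint_mem hx, rfl⟩

end Birch

/-! ### The non-negative part in projective space and in the simplex -/

section Projective

variable {d : ℕ} {A : Finset (Fin d → ℤ)} {w : A → ℝ}

theorem continuous_projectivization_mk (κ : Type*) [Fintype κ] :
    Continuous fun v : {v : κ → ℝ // v ≠ 0} => Projectivization.mk ℝ v.1 v.2 :=
  continuous_coinduced_rng

theorem ne_zero_of_mem_stdSimplex {κ : Type*} [Fintype κ] {q : κ → ℝ}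
    (hq : q ∈ stdSimplex ℝ κ) : q ≠ 0 := by
  rintro rfl
  simpa using hq.2

/-- A closed subset of the standard simplex has a closed image in real projective space. -/
theorem isClosed_projectivization_of_subset_stdSimplex {κ : Type*} [Fintype κ]
    {X : Set (κ → ℝ)} (hX : IsClosed X) (hsub : X ⊆ stdSimplex ℝ κ) :
    IsClosed {p : ℙ ℝ (κ → ℝ) | ∃ q ∈ X, ∃ h : q ≠ 0, p = Projectivization.mk ℝ q h} := by
  rw [isClosed_coinduced]
  have hsum (v : {v : κ → ℝ // v ≠ 0}) : ∑ a, |v.1 a| ≠ 0 := by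
    intro h
    rw [Finset.sum_eq_zero_iff_of_nonneg fun a _ => abs_nonneg _] at h
    exact v.2 (funext fun a => abs_eq_zero.1 (h a (Finset.mem_univ a)))
  have hscale : Continuous fun v : {v : κ → ℝ // v ≠ 0} => (∑ a, |v.1 a|)⁻¹ • v.1 := by
    refine Continuous.smul (Continuous.inv₀ ?_ hsum) continuous_subtype_val
    exact continuous_finsetSum _ fun a _ =>
      ((continuous_apply a).comp continuous_subtype_val).abs
  -- Points of the simplex have `ℓ¹` norm `1`, so a line meets `X` exactly when one of its two
  -- vectors of norm `1` lies in `X`.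
  convert (hX.preimage hscale).union (hX.preimage hscale.neg) using 1
  ext v
  constructor
  · rintro ⟨q, hq, h, hvq⟩
    obtain ⟨c, hc⟩ := (Projectivization.mk_eq_mk_iff' ℝ _ _ v.2 h).1 hvq
    have hc0 : c ≠ 0 := by
      rintro rfl
      exact v.2 (by rw [← hc, zero_smul])
    have habs : ∑ a, |v.1 a| = |c| := by
      simp only [← hc, Pi.smul_apply, smul_eq_mul, abs_mul, ← Finset.mul_sum,
        abs_of_nonneg ((hsub hq).1 _), (hsub hq).2, mul_one]
    rcases lt_or_gt_of_ne hc0 with hneg | hpos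
    · right
      change -((∑ a, |v.1 a|)⁻¹ • v.1) ∈ X
      rwa [habs, abs_of_neg hneg, ← hc, smul_smul, ← neg_smul, inv_neg, neg_mul, neg_neg,
        inv_mul_cancel₀ hc0, one_smul]
    · left
      change (∑ a, |v.1 a|)⁻¹ • v.1 ∈ X
      rwa [habs, abs_of_pos hpos, ← hc, smul_smul, inv_mul_cancel₀ hc0, one_smul]
  · have key (c : ℝ) (hc : c • v.1 ∈ X) :
        ∃ q ∈ X, ∃ h : q ≠ 0, Projectivization.mk ℝ v.1 v.2 = Projectivization.mk ℝ q h := by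
      have h0 := ne_zero_of_mem_stdSimplex (hsub hc)
      exact ⟨_, hc, h0, ((Projectivization.mk_eq_mk_iff' ℝ _ _ h0 v.2).2 ⟨c, rfl⟩).symm⟩
    rintro (h | h)
    · exact key _ h
    · refine key (-(∑ a, |v.1 a|)⁻¹) ?_
      rw [neg_smul]
      exact h

/-- This replaces the closure in projective space by one in the simplex. One inclusion uses that
closed subsets of the simplex have closed image, the other that the projection is continuous. -/
theorem toricNonnegPart_eq [Nonempty A] (hw : ∀ a, 0 < w a) :
    toricNonnegPart A w =
      {p | ∃ q ∈ simplexToric A w, ∃ h : q ≠ 0, p = Projectivization.mk ℝ q h} := by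
  have hne {x : Fin d → ℝ} (hx : ∀ i, 0 < x i) : simplexPoint A w x ≠ 0 :=
    ne_zero_of_mem_stdSimplex (simplexToric_subset_stdSimplex hw (simplexPoint_mem hx))
  have hmk {x : Fin d → ℝ} (hx : ∀ i, 0 < x i) (h : weightedMonomial A w x ≠ 0) :
      Projectivization.mk ℝ _ h = Projectivization.mk ℝ _ (hne hx) := by
    refine (Projectivization.mk_eq_mk_iff' ℝ _ _ _ _).2
      ⟨∑ b, weightedMonomial A w x b, funext fun a => ?_⟩
    exact mul_div_cancel₀ _ (sum_weightedMonomial_pos hw hx).ne'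
  apply Set.Subset.antisymm
  · refine closure_minimal ?_ (isClosed_projectivization_of_subset_stdSimplex isClosed_closure
      (simplexToric_subset_stdSimplex hw))
    rintro _ ⟨x, hx, h, rfl⟩
    exact ⟨_, simplexPoint_mem hx, hne hx, hmk hx h⟩
  · rintro _ ⟨q, hq, h, rfl⟩
    have hq' : (⟨q, h⟩ : {v : A → ℝ // v ≠ 0}) ∈
        closure {v | v.1 ∈ simplexPoint A w '' {x | ∀ i, 0 < x i}} := by
      rw [closure_subtype]
      refine closure_mono ?_ hq
      rintro _ ⟨x, hx, rfl⟩
      exact ⟨⟨_, hne hx⟩, ⟨x, hx, rfl⟩, rfl⟩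
    refine map_mem_closure (continuous_projectivization_mk A) hq' ?_
    rintro ⟨_, h'⟩ ⟨x, hx, rfl⟩
    obtain ⟨a⟩ := ‹Nonempty A›
    exact ⟨x, hx, fun h0 => (weightedMonomial_pos hw hx a).ne' (congrFun h0 a), (hmk hx _).symm⟩

theorem Patch.blend_ne_zero {ι : Type*} [Fintype ι] {pt : ι → Fin d → ℝ} (β : Patch pt)
    (x : domainPolytope pt) : (fun a => β.blend a x) ≠ 0 := by
  obtain ⟨a, ha⟩ := β.no_base_point x
  exact fun h => ha (congrFun h a)

theorem Patch.IsToric.normalized_mem [Nonempty A] (hw : ∀ a, 0 < w a) {β : Patch (realPoint A)}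
    (hβ : β.IsToric w) (x : domainPolytope (realPoint A)) :
    (fun a => β.normalized a x) ∈ simplexToric A w := by
  have hx : Projectivization.mk ℝ _ (β.blend_ne_zero x) ∈ β.image := ⟨x, _, rfl⟩
  rw [show β.image = _ from hβ, toricNonnegPart_eq hw] at hx
  obtain ⟨q, hq, h, hxq⟩ := hx
  obtain ⟨c, hc⟩ := (Projectivization.mk_eq_mk_iff' ℝ _ _ _ h).1 hxq
  have hca (a : A) : c * q a = β.blend a x := congrFun hc a
  have htot : β.total x = c := by
    simp only [Patch.total, ← hca, ← Finset.mul_sum, (simplexToric_subset_stdSimplex hw hq).2,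
      mul_one]
  convert hq using 1
  ext a
  rw [Patch.normalized, htot, ← hca, mul_div_cancel_left₀ _ (htot ▸ (β.total_pos x).ne')]

/-- The inverse of the moment map is a proper toric patch. -/
theorem exists_isToric_isProper (hA : IsPrimitive A) (hw : ∀ a, 0 < w a) :
    ∃ β : Patch (realPoint A), β.IsToric w ∧ β.IsProper := by
  have := hA.nonempty
  have : CompactSpace (simplexToric A w) :=
    isCompact_iff_compactSpace.1 (isCompact_simplexToric hw)
  let e : simplexToric A w ≃ domainPolytope (realPoint A) :=
    Equiv.ofBijective (fun p => ⟨momentMap A p.1, momentMap_mem hw p.2⟩)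
      ⟨fun p q h => Subtype.ext (momentMap_injOn hw p.2 q.2 (congrArg Subtype.val h)), fun y => by
        obtain ⟨p, hp, h⟩ := (image_momentMap_simplexToric hA hw).ge y.2
        exact ⟨⟨p, hp⟩, Subtype.ext h⟩⟩
  have hec : Continuous e :=
    ((continuous_momentMap A).comp continuous_subtype_val).subtype_mk _
  let E : simplexToric A w ≃ₜ domainPolytope (realPoint A) := hec.homeoOfEquivCompactToT2
  have hE (y : domainPolytope (realPoint A)) : (E.symm y).1 ∈ stdSimplex ℝ A :=
    simplexToric_subset_stdSimplex hw (E.symm y).2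
  let β : Patch (realPoint A) :=
    { blend := fun a y => (E.symm y).1 a
      continuous_blend := fun a =>
        (continuous_apply a).comp (continuous_subtype_val.comp E.symm.continuous)
      blend_nonneg := fun a y => (hE y).1 a
      no_base_point := fun y => by
        by_contra! h
        exact ne_zero_of_mem_stdSimplex (hE y) (funext h) }
  refine ⟨β, ?_, ?_⟩
  · change β.image = _
    rw [toricNonnegPart_eq hw]
    ext p
    constructor
    · rintro ⟨y, h, rfl⟩
      exact ⟨_, (E.symm y).2, h, rfl⟩
    · rintro ⟨q, hq, h, rfl⟩
      have hβ : (fun a => β.blend a (E ⟨q, hq⟩)) = q :=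
        congrArg Subtype.val (E.symm_apply_apply ⟨q, hq⟩)
      refine ⟨E ⟨q, hq⟩, β.blend_ne_zero _, ?_⟩
      simp only [hβ]
  · have hid : β.tautological = id := by
      ext1 y
      have htot : β.total y = 1 := (hE y).2
      have hn (a : A) : β.normalized a y = (E.symm y).1 a := by
        rw [Patch.normalized, htot, div_one]
      apply Subtype.ext
      simp only [Patch.tautological, hn, id]
      exact congrArg Subtype.val (E.apply_symm_apply y)
    unfold Patch.IsProper
    rw [hid]
    exact IsHomeomorph.id

end Projective

/-! ### Generic inverses of the logarithmic toric differential -/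

section GenericInverse

variable {d : ℕ} {A : Finset (Fin d → ℤ)} {w : A → ℝ}

/-- A real point as a complex point. -/
def complexPoint (x : Fin d → ℝ) : Fin d → ℂ := fun i => (x i : ℂ)

/-- The logarithmic toric differential at a positive real point. -/
def toricMoment (A : Finset (Fin d → ℤ)) (w : A → ℝ) (x : Fin d → ℝ) : Fin d → ℝ :=
  momentMap A (simplexPoint A w x)

theorem logToricDifferential_mapsTo [Nonempty A] (hw : ∀ a, 0 < w a) {x : Fin d → ℝ}
    (hx : ∀ i, 0 < x i) :
    (logToricDifferential A w).MapsTo (complexPoint x) (complexPoint (toricMoment A w x)) := by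
  intro j
  have hsum : ∑ a : A, (w a : ℂ) * ∏ i, complexPoint x i ^ a.1 i =
      ((∑ a, weightedMonomial A w x a : ℝ) : ℂ) := by
    simp only [weightedMonomial, complexPoint]
    push_cast
    rfl
  have h := logToricDifferential_hasValueAt A w (x := complexPoint x)
    (fun i => Complex.ofReal_ne_zero.2 (hx i).ne')
    (by rw [hsum]; exact Complex.ofReal_ne_zero.2 (sum_weightedMonomial_pos hw hx).ne') j
  convert h using 1
  rw [hsum, complexPoint, toricMoment, momentMap_apply]
  simp only [simplexPoint, div_mul_eq_mul_div, ← Finset.sum_div]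
  push_cast
  congr 1
  refine Finset.sum_congr rfl fun a _ => ?_
  simp only [weightedMonomial, complexPoint]
  push_cast
  ring

theorem isOpen_positive : IsOpen {x : Fin d → ℝ | ∀ i, 0 < x i} := by
  simp only [Set.ofPred_forall]
  exact isOpen_iInter_of_finite fun i => isOpen_lt continuous_const (continuous_apply i)

theorem isZariskiDense_positive :
    IsZariskiDense (complexPoint '' {x : Fin d → ℝ | ∀ i, 0 < x i}) :=
  isZariskiDense_ofReal_image isOpen_positive ⟨1, fun _ => one_pos⟩

/-- By Birch's theorem this set contains the interior of the polytope, which is non-empty by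
primitivity. -/
theorem isZariskiDense_toricMoment (hA : IsPrimitive A) (hw : ∀ a, 0 < w a) :
    IsZariskiDense (complexPoint '' (toricMoment A w '' {x : Fin d → ℝ | ∀ i, 0 < x i})) := by
  have := hA.nonempty
  intro P hP
  refine isZariskiDense_ofReal_image isOpen_interior hA.interior_domainPolytope_nonempty P ?_
  rintro _ ⟨y, hy, rfl⟩
  obtain ⟨x, hx, rfl⟩ := exists_momentMap_simplexPoint_eq hw hy
  exact hP _ ⟨_, ⟨x, hx, rfl⟩, rfl⟩

/-- `χ` inverts the logarithmic toric differential at the generic positive real points. -/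
def IsGenericInverse (A : Finset (Fin d → ℤ)) (w : A → ℝ) (χ : RationalSelfMap d) : Prop :=
  ∃ N : MvPolynomial (Fin d) ℂ, N ≠ 0 ∧ ∀ x : Fin d → ℝ, (∀ i, 0 < x i) →
    MvPolynomial.eval (complexPoint (toricMoment A w x)) N ≠ 0 →
      χ.MapsTo (complexPoint (toricMoment A w x)) (complexPoint x)

theorem isGenericInverse_of_compIsId [Nonempty A] (hw : ∀ a, 0 < w a) {χ : RationalSelfMap d}
    (h : RationalSelfMap.CompIsId χ (logToricDifferential A w)) : IsGenericInverse A w χ := by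
  choose R S hS hχ using fun j => exists_num_denom (χ j)
  -- Off the zeros of the denominators `χ` is defined, and the inverse property then forces its
  -- value to be `x`.
  refine ⟨∏ j, S j, Finset.prod_ne_zero_iff.2 fun j _ => hS j, fun x hx hN => ?_⟩
  rw [map_prod, Finset.prod_ne_zero_iff] at hN
  have hval : χ.MapsTo (complexPoint (toricMoment A w x)) fun j =>
      MvPolynomial.eval (complexPoint (toricMoment A w x)) (R j) /
        MvPolynomial.eval (complexPoint (toricMoment A w x)) (S j) :=
    fun j => ⟨R j, S j, hN j (Finset.mem_univ j), hχ j, rfl⟩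
  have := h.2 _ _ _ (logToricDifferential_mapsTo hw hx) hval
  rwa [this] at hval

theorem IsGenericInverse.isBirational (hA : IsPrimitive A) (hw : ∀ a, 0 < w a)
    {χ : RationalSelfMap d} (h : IsGenericInverse A w χ) :
    (logToricDifferential A w).IsBirational := by
  have := hA.nonempty
  obtain ⟨N, hN, h⟩ := h
  have hD := (isZariskiDense_toricMoment hA hw).inter_ne_zero hN
  -- `U` is the numerator of `N ∘ ψ`. It is non-zero because `N ∘ ψ` has a non-zero value somewhere;
  -- at positive `x` with `U(x) ≠ 0`, the point `ψ(x)` avoids the zeros of `N`.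
  obtain ⟨U, V, hV, hUV⟩ := exists_num_denom (MvPolynomial.aeval (logToricDifferential A w) N)
  have hU : U ≠ 0 := by
    rintro rfl
    obtain ⟨_, ⟨_, ⟨x, hx, rfl⟩, rfl⟩, hx'⟩ := hD.nonempty
    have hval := (logToricDifferential_mapsTo hw hx).hasValueAt_aeval N
    rw [hUV, map_zero, zero_div] at hval
    exact hx' (hval.unique (hasValueAt_zero _))
  refine ⟨χ, ?_, ?_⟩
  · refine RationalSelfMap.compIsId_of_isZariskiDense
      (isZariskiDense_positive.inter_ne_zero hU) ?_
    rintro _ ⟨⟨x, hx, rfl⟩, hxU⟩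
    have hψ := logToricDifferential_mapsTo hw hx
    refine ⟨_, hψ, h x hx fun h0 => hxU ?_⟩
    rw [(hψ.hasValueAt_aeval N).eval_num_eq hV hUV, h0, zero_mul]
  · refine RationalSelfMap.compIsId_of_isZariskiDense hD ?_
    rintro _ ⟨⟨_, ⟨x, hx, rfl⟩, rfl⟩, hx'⟩
    exact ⟨_, h x hx hx', logToricDifferential_mapsTo hw hx⟩

theorem exists_real_imaginary_part (P : MvPolynomial (Fin d) ℂ) :
    ∃ P₁ P₂ : MvPolynomial (Fin d) ℝ,
      P = MvPolynomial.map Complex.ofRealHom P₁ +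
        MvPolynomial.C Complex.I * MvPolynomial.map Complex.ofRealHom P₂ := by
  induction P using MvPolynomial.induction_on with
  | C z =>
    refine ⟨MvPolynomial.C z.re, MvPolynomial.C z.im, ?_⟩
    simp only [MvPolynomial.map_C, Complex.ofRealHom_eq_coe, ← map_mul, ← map_add]
    rw [mul_comm, Complex.re_add_im]
  | add P Q hP hQ =>
    obtain ⟨P₁, P₂, hP⟩ := hP
    obtain ⟨Q₁, Q₂, hQ⟩ := hQ
    refine ⟨P₁ + Q₁, P₂ + Q₂, ?_⟩
    rw [hP, hQ, map_add, map_add]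
    ring
  | mul_X P i hP =>
    obtain ⟨P₁, P₂, hP⟩ := hP
    refine ⟨P₁ * MvPolynomial.X i, P₂ * MvPolynomial.X i, ?_⟩
    rw [hP, map_mul, map_mul, MvPolynomial.map_X]
    ring

theorem eval_complexPoint_map (P : MvPolynomial (Fin d) ℝ) (y : Fin d → ℝ) :
    MvPolynomial.eval (complexPoint y) (MvPolynomial.map Complex.ofRealHom P) =
      (MvPolynomial.eval y P : ℝ) := by
  rw [MvPolynomial.eval_map]
  exact (MvPolynomial.eval₂_comp_left Complex.ofRealHom (RingHom.id ℝ) y P).symm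

/-- A continuous function on the polytope that agrees with a quotient of complex polynomials in
the interior is rational. -/
theorem isRationalFunction_of_complex (hA : IsPrimitive A) {g : domainPolytope (realPoint A) → ℝ}
    (hg : Continuous g) {P Q : MvPolynomial (Fin d) ℂ} (hQ : Q ≠ 0)
    (h : ∀ y : domainPolytope (realPoint A), y.1 ∈ interior (domainPolytope (realPoint A)) →
      MvPolynomial.eval (complexPoint y.1) P = g y * MvPolynomial.eval (complexPoint y.1) Q) :
    IsRationalFunction g := by
  obtain ⟨P₁, P₂, rfl⟩ := exists_real_imaginary_part P
  obtain ⟨Q₁, Q₂, rfl⟩ := exists_real_imaginary_part Q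
  have key {P Q : MvPolynomial (Fin d) ℝ} (hQ : Q ≠ 0)
      (h : ∀ y : domainPolytope (realPoint A), y.1 ∈ interior (domainPolytope (realPoint A)) →
        MvPolynomial.eval y.1 P = g y * MvPolynomial.eval y.1 Q) : IsRationalFunction g := by
    refine ⟨P, Q, hQ, fun y hy => ?_⟩
    rw [eq_div_iff hy]
    -- The cleared equation is a closed condition, so it extends from the dense interior to the
    -- boundary.
    have hdense : y ∈ closure {y : domainPolytope (realPoint A) |
        y.1 ∈ interior (domainPolytope (realPoint A))} := by
      rw [closure_subtype]
      refine closure_mono ?_ (hA.closure_interior_domainPolytope.ge y.2)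
      exact fun z hz => ⟨⟨z, interior_subset hz⟩, hz, rfl⟩
    have hcont (P : MvPolynomial (Fin d) ℝ) :
        Continuous fun y : domainPolytope (realPoint A) => MvPolynomial.eval y.1 P :=
      (MvPolynomial.continuous_eval P).comp continuous_subtype_val
    exact (closure_minimal (t := {y : domainPolytope (realPoint A) |
      MvPolynomial.eval y.1 P = g y * MvPolynomial.eval y.1 Q}) h
      (isClosed_eq (hcont P) (hg.mul (hcont Q))) hdense).symm
  have hparts (y : domainPolytope (realPoint A))
      (hy : y.1 ∈ interior (domainPolytope (realPoint A))) :
      MvPolynomial.eval y.1 P₁ = g y * MvPolynomial.eval y.1 Q₁ ∧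
        MvPolynomial.eval y.1 P₂ = g y * MvPolynomial.eval y.1 Q₂ := by
    have h0 := h y hy
    simp only [map_add, map_mul, MvPolynomial.eval_C, eval_complexPoint_map] at h0
    exact ⟨by simpa using congrArg Complex.re h0, by simpa using congrArg Complex.im h0⟩
  -- Since `g` is real, the equation splits into real and imaginary parts, and at least one of the
  -- two denominators is non-zero.
  by_cases hQ₁ : Q₁ = 0
  · have hQ₂ : Q₂ ≠ 0 := by
      rintro rfl
      simp [hQ₁] at hQ
    exact key hQ₂ fun y hy => (hparts y hy).2
  · exact key hQ₁ fun y hy => (hparts y hy).1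

theorem eq_simplexPoint_of_momentMap_eq [Nonempty A] (hw : ∀ a, 0 < w a)
    {b : domainPolytope (realPoint A) → A → ℝ} (hb : ∀ y, b y ∈ simplexToric A w)
    (hμ : ∀ y, momentMap A (b y) = y.1) {x : Fin d → ℝ} (hx : ∀ i, 0 < x i)
    {y : domainPolytope (realPoint A)} (hy : toricMoment A w x = y.1) :
    b y = simplexPoint A w x :=
  momentMap_injOn hw (hb y) (simplexPoint_mem hx) ((hμ y).trans hy.symm)

theorem IsGenericInverse.isRationalFunction (hA : IsPrimitive A) (hw : ∀ a, 0 < w a)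
    {χ : RationalSelfMap d} (h : IsGenericInverse A w χ)
    {b : domainPolytope (realPoint A) → A → ℝ} (hb : ∀ y, b y ∈ simplexToric A w)
    (hμ : ∀ y, momentMap A (b y) = y.1) (a : A) (hcont : Continuous fun y => b y a) :
    IsRationalFunction fun y => b y a := by
  have := hA.nonempty
  obtain ⟨N, hN, h⟩ := h
  let m (a : A) : RationalFunctionField d :=
    algebraMap _ _ (MvPolynomial.C (σ := Fin d) (w a : ℂ)) * ∏ i, χ i ^ a.1 i
  obtain ⟨P, Q, hQ, hr⟩ := exists_num_denom (m a / ∑ c, m c)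
  -- The factor `N` makes both sides vanish at the points where nothing is known about `χ`.
  refine isRationalFunction_of_complex hA hcont (P := P * N) (mul_ne_zero hQ hN) fun y hy => ?_
  rw [map_mul, map_mul]
  by_cases hNy : MvPolynomial.eval (complexPoint y.1) N = 0
  · simp [hNy]
  obtain ⟨x, hx, hxy⟩ : ∃ x : Fin d → ℝ, (∀ i, 0 < x i) ∧ toricMoment A w x = y.1 :=
    exists_momentMap_simplexPoint_eq hw hy
  have hχ := h x hx (by rwa [hxy])
  rw [hxy] at hχ
  have hm (c : A) : HasValueAt (m c) (complexPoint y.1) (weightedMonomial A w x c : ℝ) := by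
    have := (hasValueAt_algebraMap (MvPolynomial.C (w c : ℂ)) (complexPoint y.1)).mul
      (HasValueAt.finset_prod Finset.univ fun i _ =>
        (hχ i).zpow (Complex.ofReal_ne_zero.2 (hx i).ne') (c.1 i))
    convert this using 1
    simp [weightedMonomial, complexPoint]
  have hval := (hm a).div (HasValueAt.finset_sum Finset.univ fun c _ => hm c) (by
    rw [← Complex.ofReal_sum]
    exact Complex.ofReal_ne_zero.2 (sum_weightedMonomial_pos hw hx).ne')
  rw [hval.eval_num_eq hQ hr, eq_simplexPoint_of_momentMap_eq hw hb hμ hx hxy, simplexPoint]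
  push_cast
  ring

/-- Exponents of sum zero cancel the normalizing denominator, and the remaining monomial has
exponent vector the `i`-th unit vector. -/
theorem prod_simplexPoint_div_zpow [Nonempty A] (hw : ∀ a, 0 < w a) {x : Fin d → ℝ}
    (hx : ∀ i, 0 < x i) {n : A → ℤ} (hn : ∑ a, n a = 0) {i : Fin d}
    (hni : ∀ j, ∑ a, n a * a.1 j = (Pi.single i 1 : Fin d → ℤ) j) :
    ∏ a, (simplexPoint A w x a / w a) ^ n a = x i := by
  have hzsum {c : ℝ} (hc : c ≠ 0) (m : A → ℤ) : ∏ a, c ^ m a = c ^ ∑ a, m a := by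
    induction (Finset.univ : Finset A) using Finset.induction_on with
    | empty => simp
    | insert a t ha ih => rw [Finset.prod_insert ha, Finset.sum_insert ha, ih, zpow_add₀ hc]
  have hF := (sum_weightedMonomial_pos hw hx).ne'
  have hterm (a : A) : (simplexPoint A w x a / w a) ^ n a =
      (∏ j, x j ^ (n a * a.1 j)) / (∑ b, weightedMonomial A w x b) ^ n a := by
    rw [simplexPoint, div_right_comm, div_zpow, weightedMonomial,
      mul_div_cancel_left₀ _ (hw a).ne', ← Finset.prod_zpow]
    congr 1
    exact Finset.prod_congr rfl fun j _ => by rw [← zpow_mul, mul_comm]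
  rw [Finset.prod_congr rfl fun a _ => hterm a, Finset.prod_div_distrib, hzsum hF, hn, zpow_zero,
    div_one, Finset.prod_comm]
  simp only [hzsum (hx _).ne', hni]
  rw [Finset.prod_eq_single i]
  · simp
  · intro j _ hj
    simp [hj]
  · simp

theorem exists_isGenericInverse_of_isRationalFunction (hA : IsPrimitive A) (hw : ∀ a, 0 < w a)
    {b : domainPolytope (realPoint A) → A → ℝ} (hb : ∀ y, b y ∈ simplexToric A w)
    (hμ : ∀ y, momentMap A (b y) = y.1) (hrat : ∀ a, IsRationalFunction fun y => b y a) :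
    ∃ χ, IsGenericInverse A w χ := by
  have := hA.nonempty
  choose P Q hQ hPQ using hrat
  choose n hn hn' using fun i : Fin d => hA.exists_linear_relation (Pi.single i 1)
  let φ := MvPolynomial.map (σ := Fin d) Complex.ofRealHom
  -- The inverse is read off by substituting the rational blending functions into these degree-zero
  -- monomials. Negative exponents are harmless because the blending functions are positive at the
  -- points used.
  refine ⟨fun i => ∏ a, (algebraMap _ (RationalFunctionField d) (φ (P a)) /
      algebraMap _ _ (φ (Q a)) / algebraMap _ _ (MvPolynomial.C (σ := Fin d) (w a : ℂ))) ^ n i a,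
    ∏ a, φ (Q a), ?_, fun x hx hN i => ?_⟩
  · refine Finset.prod_ne_zero_iff.2 fun a _ h0 => hQ a ?_
    exact MvPolynomial.map_injective _ Complex.ofRealHom.injective (h0.trans (map_zero _).symm)
  rw [map_prod, Finset.prod_ne_zero_iff] at hN
  have hy : toricMoment A w x ∈ domainPolytope (realPoint A) :=
    momentMap_mem hw (simplexPoint_mem hx)
  have hval (a : A) : HasValueAt (algebraMap _ (RationalFunctionField d) (φ (P a)) /
      algebraMap _ _ (φ (Q a)) / algebraMap _ _ (MvPolynomial.C (σ := Fin d) (w a : ℂ)))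
      (complexPoint (toricMoment A w x)) ((simplexPoint A w x a / w a : ℝ) : ℂ) := by
    have hQa := hN a (Finset.mem_univ a)
    have h1 := ((hasValueAt_algebraMap (φ (P a)) (complexPoint (toricMoment A w x))).div
      (hasValueAt_algebraMap (φ (Q a)) _) hQa).div
      (hasValueAt_algebraMap (MvPolynomial.C (w a : ℂ)) _)
        (by simpa using (hw a).ne')
    rw [eval_complexPoint_map, Complex.ofReal_ne_zero] at hQa
    have h2 := hPQ a ⟨_, hy⟩ hQa
    simp only [eq_simplexPoint_of_momentMap_eq hw hb hμ hx (y := ⟨_, hy⟩) rfl] at h2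
    convert h1 using 1
    rw [eval_complexPoint_map, eval_complexPoint_map, MvPolynomial.eval_C, h2]
    push_cast
    rfl
  have hprod := HasValueAt.finset_prod Finset.univ fun a _ => (hval a).zpow
    (Complex.ofReal_ne_zero.2 (div_pos (simplexPoint_pos hw hx a) (hw a)).ne') (n i a)
  convert hprod using 1
  rw [complexPoint, ← prod_simplexPoint_div_zpow hw hx (hn i) (hn' i)]
  push_cast
  rfl

end GenericInverse

/-! ### Rational linear precision -/

section Precision

variable {d : ℕ} {A : Finset (Fin d → ℤ)} {w : A → ℝ}

theorem Patch.continuous_normalized {ι : Type*} [Fintype ι] {pt : ι → Fin d → ℝ} (β : Patch pt)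
    (a : ι) : Continuous (β.normalized a) :=
  (β.continuous_blend a).div (continuous_finsetSum _ fun b _ => β.continuous_blend b)
    fun x => (β.total_pos x).ne'

/-- The coordinate functions and the constants span the affine functions, and constants are always
reproduced by a partition of unity. -/
theorem Patch.hasLinearPrecision_iff (β : Patch (realPoint A)) :
    β.HasLinearPrecision ↔ ∀ y, momentMap A (fun a => β.normalized a y) = y.1 := by
  constructor
  · intro h y
    ext j
    rw [momentMap_apply]
    exact (h (LinearMap.proj j : (Fin d → ℝ) →ₗ[ℝ] ℝ).toAffineMap y).symm
  · intro h Λ y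
    have hΛ (v : Fin d → ℝ) : Λ v = Λ.linear v + Λ 0 := congrFun Λ.decomp v
    rw [hΛ, Finset.sum_congr rfl fun a _ => by rw [hΛ (realPoint A a), mul_add],
      Finset.sum_add_distrib, ← Finset.sum_mul, β.sum_normalized, one_mul, ← h y, momentMap,
      map_sum]
    simp

theorem Patch.IsToric.hasRationalLinearPrecision_iff (hA : IsPrimitive A) (hw : ∀ a, 0 < w a)
    {β : Patch (realPoint A)} (hβ : β.IsToric w) (hproper : β.IsProper) :
    β.HasRationalLinearPrecision ↔ (logToricDifferential A w).IsBirational := by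
  have := hA.nonempty
  constructor
  · rintro ⟨-, h, hlin, hrat⟩
    obtain ⟨χ, hχ⟩ := exists_isGenericInverse_of_isRationalFunction hA hw
      (b := fun y a => (β.reparam h).normalized a y) (fun y => hβ.normalized_mem hw (h y))
      ((β.reparam h).hasLinearPrecision_iff.1 hlin) hrat
    exact hχ.isBirational hA hw
  · rintro ⟨χ, hχ, -⟩
    -- Reparametrizing by the inverse of the tautological map makes the new tautological map the
    -- identity, which is linear precision.
    let h := (hproper.homeomorph β.tautological).symm
    have hμ (y : domainPolytope (realPoint A)) :
        momentMap A (fun a => (β.reparam h).normalized a y) = y.1 :=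
      congrArg Subtype.val ((hproper.homeomorph β.tautological).apply_symm_apply y)
    exact ⟨hproper, h, (β.reparam h).hasLinearPrecision_iff.2 hμ, fun a =>
      (isGenericInverse_of_compIsId hw hχ).isRationalFunction hA hw
        (b := fun y a => (β.reparam h).normalized a y) (fun y => hβ.normalized_mem hw (h y)) hμ a
        ((β.reparam h).continuous_normalized a)⟩

end Precision

end

theorem theorem3p6 {d : ℕ} (A : Finset (Fin d → ℤ)) (hA : IsPrimitive A)
    (w : A → ℝ) (hw : ∀ a, 0 < w a) :
    (∀ β : Patch (realPoint A), β.IsToric w → β.IsProper →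
      (β.HasRationalLinearPrecision ↔ (logToricDifferential A w).IsBirational)) ∧
    ((∃ β : Patch (realPoint A), β.IsToric w ∧ β.HasRationalLinearPrecision) ↔
      (logToricDifferential A w).IsBirational) := by
  refine ⟨fun β hβ hp => hβ.hasRationalLinearPrecision_iff hA hw hp, ?_, fun h => ?_⟩
  · rintro ⟨β, hβ, hr⟩
    exact (hβ.hasRationalLinearPrecision_iff hA hw hr.1).1 hr
  · obtain ⟨β, hβ, hp⟩ := exists_isToric_isProper hA hw
    exact ⟨β, hβ, (hβ.hasRationalLinearPrecision_iff hA hw hp).2 h⟩
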